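/- All Banach spaces are real. A *lattice homomorphism* between Banach lattices is a bounded linear operator that preserves the lattice operations $\vee$ and $\wedge$; $\mathrm{Hom}(X,\mathbb R)$ denotes the set of all lattice homomorphisms $X\to\mathbb R$, and $X_+=\{x\in X: x\ge 0\}$. For a Banach space $E$ with dual $E^*$ and closed unit ball $B_E$, let $H_0[E]$ be the Banach lattice (with pointwise order) of all functions $f:E^*\to\mathbb R$ with $f(\lambda x^*)=\lambda f(x^*)$ for all $\lambda>0$, $x^*\in E^*$, and $$\|f\|_{FBL[E]}=\sup\Big\{\sum_{i=1}^n|f(x_i^*)| : n\in\mathbb N,\ x_1^*,\dots,x_n^*\in E^*,\ \sup_{x\in B_E}\sum_{i=1}^n|x_i^*(x)|\le 1\Big\}<\infty .$$ The free Banach lattice $FBL[E]$ is the smallest closed vector sublattice of $H_0[E]$ containing the evaluations $\delta_E(x):x^*\mapsto x^*(x)$, $x\in E$. For a Banach lattice $X$, let $\beta_X:FBL[X]\to X$ be the unique lattice homomorphism with $\beta_X\circ\delta_X=\mathrm{id}_X$. The Banach lattice $X$ has the *lattice-lifting property* if there is a lattice homomorphism $T:X\to FBL[X]$ with $\beta_X\circ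 T=\mathrm{id}_X$. The Banach lattice $X$ satisfies the *$\sigma$-bounded chain condition* if $X_+\setminus\{0\}=\bigcup_{n\ge 2}\mathcal F_n$ for some sets $\mathcal F_n$ such that, for each $n\ge2$ and each $\mathcal G\subseteq\mathcal F_n$ of cardinality $n$, there are distinct $x,y\in\mathcal G$ with $x\wedge y\ne 0$. **Corollary.** Let $X$ be a Banach lattice with the lattice-lifting property. Then: (i) $\mathrm{Hom}(X,\mathbb R)$ separates the points of $X$, that is, for all $x\neq y$ in $X$ there is $\varphi\in\mathrm{Hom}(X,\mathbb R)$ with $\varphi(x)\ne\varphi(y)$; (ii) $X$ satisfies the $\sigma$-bounded chain condition. -/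

import Mathlib

open scoped ENNReal

noncomputable section

set_option linter.unusedSectionVars false

namespace BanachLatticeLifting

/-- A lattice homomorphism between Banach lattices: a bounded linear operator preserving the
lattice operations. -/
structure IsLatticeHom {X Y : Type*} [NormedAddCommGroup X] [NormedSpace ℝ X] [Lattice X]
    [NormedAddCommGroup Y] [NormedSpace ℝ Y] [Lattice Y] (T : X →L[ℝ] Y) : Prop where
  map_sup : ∀ x y, T (x ⊔ y) = T x ⊔ T y
  map_inf : ∀ x y, T (x ⊓ y) = T x ⊓ T y

section Free

variable (E : Type*) [NormedAddCommGroup E] [NormedSpace ℝ E]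

variable {E} in
/-- Admissible finite families in the dual: `sup_{x ∈ B_E} ∑ i, |φ i x| ≤ 1`. -/
def Admissible {n : ℕ} (φ : Fin n → StrongDual ℝ E) : Prop :=
  ∀ x : E, ‖x‖ ≤ 1 → ∑ i, |φ i x| ≤ 1

variable {E} in
/-- The extended norm of a function on the dual: the supremum of `∑ i, |f (φ i)|` over all
admissible finite families `φ`. -/
def fblNorm (f : StrongDual ℝ E → ℝ) : ℝ≥0∞ :=
  ⨆ (n : ℕ) (φ : Fin n → StrongDual ℝ E) (_ : Admissible φ), ∑ i, ENNReal.ofReal |f (φ i)|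

variable {E} in
/-- Positive homogeneity. -/
def PosHomogeneous (f : StrongDual ℝ E → ℝ) : Prop :=
  ∀ (c : ℝ) (φ : StrongDual ℝ E), 0 < c → f (c • φ) = c * f φ

variable {E}

theorem fblNorm_le {f : StrongDual ℝ E → ℝ} {C : ℝ≥0∞}
    (h : ∀ (n : ℕ) (φ : Fin n → StrongDual ℝ E), Admissible φ →
      ∑ i, ENNReal.ofReal |f (φ i)| ≤ C) : fblNorm f ≤ C :=
  iSup_le fun n => iSup_le fun φ => iSup_le fun hφ => h n φ hφ

theorem le_fblNorm (f : StrongDual ℝ E → ℝ) {n : ℕ} (φ : Fin n → StrongDual ℝ E)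
    (hφ : Admissible φ) : ∑ i, ENNReal.ofReal |f (φ i)| ≤ fblNorm f :=
  le_iSup_of_le n (le_iSup_of_le φ (le_iSup_of_le hφ le_rfl))

theorem fblNorm_le_add {f g h : StrongDual ℝ E → ℝ} (H : ∀ φ, |h φ| ≤ |f φ| + |g φ|) :
    fblNorm h ≤ fblNorm f + fblNorm g := by
  refine fblNorm_le fun n φ hφ => ?_
  refine le_trans ?_ (add_le_add (le_fblNorm f φ hφ) (le_fblNorm g φ hφ))
  rw [← Finset.sum_add_distrib]
  refine Finset.sum_le_sum fun i _ => ?_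
  rw [← ENNReal.ofReal_add (abs_nonneg _) (abs_nonneg _)]
  exact ENNReal.ofReal_le_ofReal (H _)

theorem fblNorm_mono {f g : StrongDual ℝ E → ℝ} (H : ∀ φ, |f φ| ≤ |g φ|) :
    fblNorm f ≤ fblNorm g :=
  fblNorm_le fun _ φ hφ => le_trans
    (Finset.sum_le_sum fun _ _ => ENNReal.ofReal_le_ofReal (H _)) (le_fblNorm g φ hφ)

theorem fblNorm_zero : fblNorm (0 : StrongDual ℝ E → ℝ) = 0 :=
  le_antisymm (fblNorm_le fun _ _ _ => by simp) bot_le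

theorem fblNorm_smul_le (c : ℝ) (f : StrongDual ℝ E → ℝ) :
    fblNorm (c • f) ≤ ENNReal.ofReal |c| * fblNorm f := by
  refine fblNorm_le fun n φ hφ => ?_
  refine le_trans (le_of_eq ?_) (mul_le_mul_right (le_fblNorm f φ hφ) _)
  rw [Finset.mul_sum]
  refine Finset.sum_congr rfl fun i _ => ?_
  rw [← ENNReal.ofReal_mul (abs_nonneg _), Pi.smul_apply, smul_eq_mul, abs_mul]

variable (E) in
/-- The vector space of positively homogeneous functions on the dual with finite norm, as a
subspace of the space of all functions. -/
def H0Submodule : Submodule ℝ (StrongDual ℝ E → ℝ) where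
  carrier := {f | PosHomogeneous f ∧ fblNorm f < ∞}
  zero_mem' := ⟨fun c φ _ => by simp, by rw [fblNorm_zero]; exact ENNReal.zero_lt_top⟩
  add_mem' := fun {f g} hf hg =>
    ⟨fun c φ hc => by simp only [Pi.add_apply, hf.1 c φ hc, hg.1 c φ hc]; ring,
      (fblNorm_le_add fun φ => abs_add_le (f φ) (g φ)).trans_lt
        (ENNReal.add_lt_top.2 ⟨hf.2, hg.2⟩)⟩
  smul_mem' := fun a f hf =>
    ⟨fun c φ hc => by simp only [Pi.smul_apply, smul_eq_mul, hf.1 c φ hc]; ring,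
      (fblNorm_smul_le a f).trans_lt (ENNReal.mul_lt_top ENNReal.ofReal_lt_top hf.2)⟩

variable (E) in
/-- The Banach lattice `H₀[E]` of positively homogeneous functions on the dual with finite norm.
This is a type of its own, so that its topology is the one of the norm and not the pointwise
one. -/
def H0 : Type _ := ↥(H0Submodule E)

namespace H0

instance : AddCommGroup (H0 E) := inferInstanceAs (AddCommGroup ↥(H0Submodule E))

instance : Module ℝ (H0 E) := inferInstanceAs (Module ℝ ↥(H0Submodule E))

instance : CoeFun (H0 E) (fun _ => StrongDual ℝ E → ℝ) := ⟨fun f => f.1⟩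

theorem ext {f g : H0 E} (h : ∀ φ, f φ = g φ) : f = g := Subtype.ext (funext h)

/-- The pointwise order and lattice operations. -/
instance : Lattice (H0 E) :=
  Subtype.lattice (P := fun f => f ∈ H0Submodule E)
    (fun f g hf hg => ⟨fun c φ hc => by
      simp only [Pi.sup_apply, hf.1 c φ hc, hg.1 c φ hc, mul_max_of_nonneg _ _ hc.le],
      (fblNorm_le_add fun φ => abs_max_le_max_abs_abs.trans
        (max_le_add_of_nonneg (abs_nonneg _) (abs_nonneg _))).trans_lt
        (ENNReal.add_lt_top.2 ⟨hf.2, hg.2⟩)⟩)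
    (fun f g hf hg => ⟨fun c φ hc => by
      simp only [Pi.inf_apply, hf.1 c φ hc, hg.1 c φ hc, mul_min_of_nonneg _ _ hc.le],
      (fblNorm_le_add fun φ => abs_min_le_max_abs_abs.trans
        (max_le_add_of_nonneg (abs_nonneg _) (abs_nonneg _))).trans_lt
        (ENNReal.add_lt_top.2 ⟨hf.2, hg.2⟩)⟩)

theorem le_def {f g : H0 E} : f ≤ g ↔ ∀ φ, f φ ≤ g φ := Iff.rfl

@[simp] theorem add_apply (f g : H0 E) (φ) : (f + g) φ = f φ + g φ := rfl

@[simp] theorem neg_apply (f : H0 E) (φ) : (-f) φ = -f φ := rfl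

@[simp] theorem zero_apply (φ) : (0 : H0 E) φ = 0 := rfl

@[simp] theorem smul_apply (c : ℝ) (f : H0 E) (φ) : (c • f) φ = c * f φ := rfl

@[simp] theorem sup_apply (f g : H0 E) (φ) : (f ⊔ g) φ = f φ ⊔ g φ := rfl

@[simp] theorem inf_apply (f g : H0 E) (φ) : (f ⊓ g) φ = f φ ⊓ g φ := rfl

@[simp] theorem abs_apply (f : H0 E) (φ) : |f| φ = |f φ| := rfl

instance : Norm (H0 E) := ⟨fun f => (fblNorm (f : StrongDual ℝ E → ℝ)).toReal⟩

theorem norm_def (f : H0 E) : ‖f‖ = (fblNorm (f : StrongDual ℝ E → ℝ)).toReal := rfl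

theorem eq_zero_of_norm (f : H0 E) (h : ‖f‖ = 0) : f = 0 := by
  have h0 : fblNorm (f : StrongDual ℝ E → ℝ) = 0 := by
    rcases (ENNReal.toReal_eq_zero_iff _).1 h with h | h
    · exact h
    · exact absurd h f.2.2.ne
  refine ext fun φ => ?_
  have hc : 0 < (‖φ‖ + 1)⁻¹ := by positivity
  have hadm : Admissible (fun _ : Fin 1 => (‖φ‖ + 1)⁻¹ • φ) := by
    intro x hx
    have h1 : |φ x| ≤ ‖φ‖ + 1 := by
      have := φ.le_opNorm x
      rw [Real.norm_eq_abs] at this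
      nlinarith [norm_nonneg φ, norm_nonneg x]
    simp only [Finset.univ_unique, Finset.sum_const, Finset.card_singleton, one_smul,
      _root_.smul_apply, smul_eq_mul, abs_mul, abs_of_pos hc]
    rw [inv_mul_le_iff₀ (by positivity)]
    simpa using h1
  have h2 := le_fblNorm (f : StrongDual ℝ E → ℝ) _ hadm
  rw [h0] at h2
  have h3 : |f ((‖φ‖ + 1)⁻¹ • φ)| ≤ 0 := by simpa using h2
  have h4 := abs_nonpos_iff.1 h3
  rw [f.2.1 _ φ hc] at h4
  simpa [hc.ne'] using h4

theorem norm_smul_le' (c : ℝ) (f : H0 E) : ‖c • f‖ ≤ |c| * ‖f‖ := by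
  rw [norm_def, norm_def, ← ENNReal.toReal_ofReal (abs_nonneg c), ← ENNReal.toReal_mul]
  exact ENNReal.toReal_mono (ENNReal.mul_lt_top ENNReal.ofReal_lt_top f.2.2).ne
    (fblNorm_smul_le c f.1)

theorem core : NormedSpace.Core ℝ (H0 E) where
  norm_nonneg _ := ENNReal.toReal_nonneg
  norm_smul c f := by
    refine le_antisymm (norm_smul_le' c f) ?_
    rcases eq_or_ne c 0 with rfl | hc
    · rw [norm_zero, zero_mul]
      exact ENNReal.toReal_nonneg
    · have h := norm_smul_le' c⁻¹ (c • f)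
      rw [smul_smul, inv_mul_cancel₀ hc, one_smul, abs_inv,
        le_inv_mul_iff₀ (abs_pos.2 hc)] at h
      exact h
  norm_triangle f g := by
    rw [norm_def, norm_def, norm_def, ← ENNReal.toReal_add f.2.2.ne g.2.2.ne]
    exact ENNReal.toReal_mono (ENNReal.add_lt_top.2 ⟨f.2.2, g.2.2⟩).ne
      (fblNorm_le_add fun φ => abs_add_le (f φ) (g φ))
  norm_eq_zero_iff f := ⟨eq_zero_of_norm f, fun h => by
    subst h
    exact (congrArg ENNReal.toReal fblNorm_zero)⟩

instance : NormedAddCommGroup (H0 E) := NormedAddCommGroup.ofCore core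

instance : NormedSpace ℝ (H0 E) := NormedSpace.ofCore core

instance : IsOrderedAddMonoid (H0 E) where
  add_le_add_left _ _ h c := fun φ => add_le_add_left (h φ) (c φ)

instance : HasSolidNorm (H0 E) where
  solid _ g h := ENNReal.toReal_mono g.2.2.ne (fblNorm_mono h)

end H0

theorem fblNorm_eval_le (x : E) :
    fblNorm (fun φ : StrongDual ℝ E => φ x) ≤ ENNReal.ofReal ‖x‖ := by
  refine fblNorm_le fun n φ hφ => ?_
  rw [← ENNReal.ofReal_sum_of_nonneg fun _ _ => abs_nonneg _]
  refine ENNReal.ofReal_le_ofReal ?_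
  rcases eq_or_ne x 0 with rfl | hx
  · simp
  · have hx' : 0 < ‖x‖ := norm_pos_iff.2 hx
    have h := hφ (‖x‖⁻¹ • x) (by rw [norm_smul, norm_inv, norm_norm, inv_mul_cancel₀ hx'.ne'])
    simp only [map_smul, smul_eq_mul, abs_mul, abs_inv, abs_norm, ← Finset.mul_sum] at h
    rwa [inv_mul_le_iff₀ hx', mul_one] at h

/-- The evaluation map `δ_E(x) : φ ↦ φ x`, as an element of `H₀[E]`. -/
def evalH0 (x : E) : H0 E :=
  ⟨fun φ => φ x, fun _ _ _ => rfl, (fblNorm_eval_le x).trans_lt ENNReal.ofReal_lt_top⟩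

@[simp] theorem evalH0_apply (x : E) (φ : StrongDual ℝ E) : evalH0 x φ = φ x := rfl

variable (E) in
/-- The free Banach lattice `FBL[E]`: the smallest norm-closed vector sublattice of `H₀[E]`
containing all evaluations `δ_E(x)`, `x ∈ E`. -/
def FBL : Submodule ℝ (H0 E) :=
  sInf {S : Submodule ℝ (H0 E) | IsClosed (S : Set (H0 E)) ∧
    (∀ f ∈ S, ∀ g ∈ S, f ⊔ g ∈ S) ∧ (∀ f ∈ S, ∀ g ∈ S, f ⊓ g ∈ S) ∧ ∀ x : E, evalH0 x ∈ S}

theorem evalH0_mem (x : E) : evalH0 x ∈ FBL E :=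
  Submodule.mem_sInf.2 fun _ hS => hS.2.2.2 x

/-- The order and the lattice operations of `FBL[E]` are those of `H₀[E]`, i.e. pointwise. -/
instance : Lattice ↥(FBL E) :=
  Subtype.lattice (P := fun f => f ∈ FBL E)
    (fun _ _ hf hg => Submodule.mem_sInf.2 fun S hS =>
      hS.2.1 _ (Submodule.mem_sInf.1 hf S hS) _ (Submodule.mem_sInf.1 hg S hS))
    (fun _ _ hf hg => Submodule.mem_sInf.2 fun S hS =>
      hS.2.2.1 _ (Submodule.mem_sInf.1 hf S hS) _ (Submodule.mem_sInf.1 hg S hS))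

/-- The canonical map `δ_E : E → FBL[E]`. -/
def delta (x : E) : ↥(FBL E) := ⟨evalH0 x, evalH0_mem x⟩

end Free

section Lifting

variable {X : Type*} [NormedAddCommGroup X] [NormedSpace ℝ X] [Lattice X]

/-- `β : FBL[X] → X` is a lattice homomorphism with `β ∘ δ_X = id_X`. There is exactly one such
map: see `IsBarycenter.unique` and `exists_isBarycenter`. -/
def IsBarycenter (β : ↥(FBL X) →L[ℝ] X) : Prop :=
  IsLatticeHom β ∧ ∀ x : X, β (delta x) = x

theorem IsBarycenter.unique {β γ : ↥(FBL X) →L[ℝ] X} (hβ : IsBarycenter β)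
    (hγ : IsBarycenter γ) : β = γ := by
  let L : Submodule ℝ ↥(FBL X) := LinearMap.ker ((β - γ : ↥(FBL X) →L[ℝ] X) : ↥(FBL X) →ₗ[ℝ] X)
  have hL : ∀ f, f ∈ L ↔ β f = γ f := fun f => by
    simp [L, LinearMap.mem_ker, sub_eq_zero]
  have hcl : IsClosed (L : Set ↥(FBL X)) := (β - γ : ↥(FBL X) →L[ℝ] X).isClosed_ker
  have hFcl : IsClosed ((FBL X : Submodule ℝ (H0 X)) : Set (H0 X)) := by
    rw [FBL, Submodule.coe_sInf]
    exact isClosed_biInter fun S hS => hS.1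
  have key : FBL X ≤ L.map (FBL X).subtype := by
    refine sInf_le ⟨?_, ?_, ?_, ?_⟩
    · have := hFcl.isClosedEmbedding_subtypeVal.isClosedMap _ hcl
      rw [Submodule.map_coe]
      exact this
    · rintro _ ⟨f, hf, rfl⟩ _ ⟨g, hg, rfl⟩
      refine ⟨f ⊔ g, (hL _).2 ?_, rfl⟩
      rw [hβ.1.map_sup, hγ.1.map_sup, (hL f).1 hf, (hL g).1 hg]
    · rintro _ ⟨f, hf, rfl⟩ _ ⟨g, hg, rfl⟩
      refine ⟨f ⊓ g, (hL _).2 ?_, rfl⟩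
      rw [hβ.1.map_inf, hγ.1.map_inf, (hL f).1 hf, (hL g).1 hg]
    · intro x
      exact ⟨delta x, (hL _).2 (by rw [hβ.2, hγ.2]), rfl⟩
  ext f
  obtain ⟨g, hg, hgf⟩ := key f.2
  obtain rfl : g = f := Subtype.ext hgf
  exact (hL _).1 hg

/-- Positive functionals. -/
def Pos (y : StrongDual ℝ X) : Prop := ∀ x : X, 0 ≤ x → 0 ≤ y x

/-- `y` is a finite sum of functionals satisfying `P`. -/
inductive Dec (P : StrongDual ℝ X → Prop) : StrongDual ℝ X → Prop
  | leaf (y : StrongDual ℝ X) : P y → Dec P y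
  | add (y z : StrongDual ℝ X) : Dec P y → Dec P z → Dec P (y + z)

theorem Pos.add {y z : StrongDual ℝ X} (hy : Pos y) (hz : Pos z) : Pos (y + z) :=
  fun x hx => add_nonneg (hy x hx) (hz x hx)

theorem Dec.bind {P Q : StrongDual ℝ X → Prop} {y : StrongDual ℝ X} (h : Dec P y)
    (H : ∀ z, P z → Dec Q z) : Dec Q y := by
  induction h with
  | leaf y hy => exact H y hy
  | add y z _ _ h1 h2 => exact Dec.add y z h1 h2

theorem Dec.pos {P : StrongDual ℝ X → Prop} {y : StrongDual ℝ X} (h : Dec P y)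
    (H : ∀ z, P z → Pos z) : Pos y := by
  induction h with
  | leaf y hy => exact H y hy
  | add y z _ _ h1 h2 => exact h1.add h2

theorem Dec.with_sub_pos {P : StrongDual ℝ X → Prop} {y : StrongDual ℝ X} (h : Dec P y)
    (H : ∀ z, P z → Pos z) : Dec (fun z => P z ∧ Pos (y - z)) y := by
  induction h with
  | leaf y hy => exact Dec.leaf y ⟨hy, fun x _ => by simp⟩
  | add y z hy hz h1 h2 =>
    refine Dec.add y z (h1.bind fun w hw => Dec.leaf w ⟨hw.1, ?_⟩)
      (h2.bind fun w hw => Dec.leaf w ⟨hw.1, ?_⟩)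
    · rw [show y + z - w = (y - w) + z by abel]
      exact hw.2.add (hz.pos H)
    · rw [show y + z - w = y + (z - w) by abel]
      exact (hy.pos H).add hw.2

theorem Dec.exists_fin {P : StrongDual ℝ X → Prop} {y : StrongDual ℝ X} (h : Dec P y) :
    ∃ (n : ℕ) (φ : Fin n → StrongDual ℝ X), (∀ i, P (φ i)) ∧ ∑ i, φ i = y := by
  induction h with
  | leaf y hy => exact ⟨1, fun _ => y, fun _ => hy, by simp⟩
  | add y z _ _ h1 h2 =>
    obtain ⟨n, φ, hφ, rfl⟩ := h1
    obtain ⟨m, ψ, hψ, rfl⟩ := h2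
    refine ⟨n + m, Fin.append φ ψ, fun i => ?_, ?_⟩
    · refine Fin.addCases (fun j => ?_) (fun j => ?_) i
      · rw [Fin.append_left]
        exact hφ j
      · rw [Fin.append_right]
        exact hψ j
    · simp [Fin.sum_univ_add]

/-- On the order interval `[0, y]` the function `f` is the evaluation at `x`. -/
def Good (f : H0 X) (x : X) (y : StrongDual ℝ X) : Prop :=
  Pos y ∧ ∀ z, Pos z → Pos (y - z) → f z = z x

theorem Good.mono {f : H0 X} {x : X} {y z : StrongDual ℝ X} (h : Good f x y) (hz : Pos z)
    (hyz : Pos (y - z)) : Good f x z :=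
  ⟨hz, fun w hw hzw => h.2 w hw (by
    rw [show y - w = (y - z) + (z - w) by abel]
    exact hyz.add hzw)⟩

/-- Every positive functional is a finite sum of good ones. -/
def Compat (f : H0 X) (x : X) : Prop := ∀ y, Pos y → Dec (Good f x) y

theorem Compat.both {f g : H0 X} {x x' : X} (hf : Compat f x) (hg : Compat g x')
    (y : StrongDual ℝ X) (hy : Pos y) : Dec (fun z => Good f x z ∧ Good g x' z) y :=
  (hf y hy).bind fun z hz => ((hg z hz.1).with_sub_pos fun _ h => h.1).bind fun w hw =>
    Dec.leaf w ⟨hz.mono hw.1.1 hw.2, hw.1⟩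

theorem compat_eval (x : X) : Compat (evalH0 x) x :=
  fun y hy => Dec.leaf y ⟨hy, fun _ _ _ => rfl⟩

theorem Compat.add {f g : H0 X} {x x' : X} (hf : Compat f x) (hg : Compat g x') :
    Compat (f + g) (x + x') := fun y hy => (hf.both hg y hy).bind fun z hz =>
  Dec.leaf z ⟨hz.1.1, fun w h1 h2 => by
    rw [H0.add_apply, hz.1.2 w h1 h2, hz.2.2 w h1 h2, map_add]⟩

theorem Compat.smul {f : H0 X} {x : X} (c : ℝ) (hf : Compat f x) :
    Compat (c • f) (c • x) := fun y hy => (hf y hy).bind fun z hz =>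
  Dec.leaf z ⟨hz.1, fun w h1 h2 => by
    rw [H0.smul_apply, hz.2 w h1 h2, map_smul, smul_eq_mul]⟩

section BanachLattice

variable [IsOrderedAddMonoid X] [IsOrderedModule ℝ X] [HasSolidNorm X]

theorem smul_sup_zero {c : ℝ} (hc : 0 ≤ c) (x : X) : (c • x) ⊔ 0 = c • (x ⊔ 0) := by
  rcases hc.eq_or_lt with rfl | hc
  · simp
  · refine le_antisymm (sup_le (smul_le_smul_of_nonneg_left le_sup_left hc.le)
      (smul_nonneg hc.le le_sup_right)) ?_
    have h : x ⊔ 0 ≤ c⁻¹ • ((c • x) ⊔ 0) := by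
      refine sup_le ?_ (smul_nonneg (inv_nonneg.2 hc.le) le_sup_right)
      have := smul_le_smul_of_nonneg_left (le_sup_left : c • x ≤ (c • x) ⊔ 0) (inv_nonneg.2 hc.le)
      rwa [smul_smul, inv_mul_cancel₀ hc.ne', one_smul] at this
    have := smul_le_smul_of_nonneg_left h hc.le
    rwa [smul_smul, mul_inv_cancel₀ hc.ne', one_smul] at this

theorem add_sup_zero_le (x y : X) : (x + y) ⊔ 0 ≤ (x ⊔ 0) + (y ⊔ 0) :=
  sup_le (add_le_add le_sup_left le_sup_left) (add_nonneg le_sup_right le_sup_right)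

theorem norm_sup_zero_le (x : X) : ‖x ⊔ 0‖ ≤ ‖x‖ := by
  refine norm_le_norm_of_abs_le_abs ?_
  rw [abs_of_nonneg (le_sup_right : (0 : X) ≤ x ⊔ 0)]
  exact sup_le (le_abs_self x) (abs_nonneg x)

/-- Hahn-Banach extension from a line, below a monotone sublinear function of the positive
part. -/
theorem exists_functional (N : X → ℝ) (C : ℝ) (hC : ∀ x, N x ≤ C * ‖x‖)
    (hsmul : ∀ c : ℝ, 0 < c → ∀ x, N (c • x) = c * N x)
    (hadd : ∀ x y, N (x + y) ≤ N x + N y) (w : X) (hw : w ≠ 0) (r : ℝ)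
    (h1 : r ≤ N w) (h2 : -r ≤ N (-w)) (h0 : 0 ≤ N 0) :
    ∃ y : StrongDual ℝ X, y w = r ∧ ∀ x, y x ≤ N x := by
  obtain ⟨g, hg, hgN⟩ := exists_extension_of_le_sublinear (LinearPMap.mkSpanSingleton w r hw) N
    hsmul hadd (by
      rintro ⟨x, hx⟩
      obtain ⟨t, rfl⟩ := Submodule.mem_span_singleton.1 hx
      rw [LinearPMap.mkSpanSingleton'_apply, RingHom.id_apply]
      rcases lt_trichotomy t 0 with ht | rfl | ht
      · have := hsmul (-t) (neg_pos.2 ht) (-w)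
        rw [neg_smul_neg] at this
        simp only [this, smul_eq_mul]
        nlinarith
      · simpa using h0
      · simp only [hsmul t ht, smul_eq_mul]
        nlinarith)
  refine ⟨g.mkContinuous C fun x => ?_, ?_, hgN⟩
  · rw [Real.norm_eq_abs, abs_le]
    refine ⟨?_, (hgN x).trans (hC x)⟩
    have := (hgN (-x)).trans (hC (-x))
    rw [map_neg, norm_neg] at this
    linarith
  · have := hg ⟨w, Submodule.mem_span_singleton_self w⟩
    rw [LinearPMap.mkSpanSingleton_apply] at this
    exact this

theorem exists_norming (x : X) :
    ∃ y : StrongDual ℝ X, Pos y ∧ (∀ z, y z ≤ ‖z‖) ∧ y |x| = ‖x‖ := by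
  rcases eq_or_ne x 0 with rfl | hx
  · exact ⟨0, fun _ _ => le_rfl, fun z => norm_nonneg z, by simp⟩
  have hx' : |x| ≠ 0 := by
    rw [← norm_ne_zero_iff, norm_abs_eq_norm]
    exact norm_ne_zero_iff.2 hx
  obtain ⟨y, hy, hyN⟩ := exists_functional (fun z : X => ‖z ⊔ 0‖) 1
    (fun z => by simpa using norm_sup_zero_le z)
    (fun c hc z => by
      show ‖(c • z) ⊔ 0‖ = c * ‖z ⊔ 0‖
      rw [smul_sup_zero hc.le, norm_smul, Real.norm_eq_abs, abs_of_pos hc])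
    (fun a b => by
      refine le_trans (norm_le_norm_of_abs_le_abs ?_) (norm_add_le _ _)
      rw [abs_of_nonneg le_sup_right, abs_of_nonneg (add_nonneg le_sup_right le_sup_right)]
      exact add_sup_zero_le a b)
    |x| hx' ‖x‖ (by
      show ‖x‖ ≤ ‖|x| ⊔ 0‖
      rw [sup_eq_left.2 (abs_nonneg x), norm_abs_eq_norm])
    (by linarith [norm_nonneg x, norm_nonneg (-|x| ⊔ 0)]) (norm_nonneg _)
  refine ⟨y, fun z hz => ?_, fun z => (hyN z).trans (norm_sup_zero_le z), hy⟩
  have := hyN (-z)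
  rw [sup_eq_right.2 (neg_nonpos.2 hz), norm_zero, map_neg] at this
  linarith

/-- Splitting a positive functional along the positive and the negative part of `w`. -/
theorem exists_split (y : StrongDual ℝ X) (hy : Pos y) (w : X) :
    ∃ z : StrongDual ℝ X, Pos z ∧ Pos (y - z) ∧ (y - z) (w ⊔ 0) = 0 ∧ z (-w ⊔ 0) = 0 := by
  rcases eq_or_ne w 0 with rfl | hw
  · exact ⟨0, fun _ _ => le_rfl, by simpa using hy, by simp, by simp⟩
  have hmono : ∀ a b : X, a ≤ b → y a ≤ y b := fun a b hab => by
    have := hy (b - a) (sub_nonneg.2 hab)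
    rw [map_sub] at this
    linarith
  have hdec : (w ⊔ 0) - (-w ⊔ 0) = w := posPart_sub_negPart w
  obtain ⟨z, hz, hzN⟩ := exists_functional (fun x : X => y (x ⊔ 0)) ‖y‖
    (fun x => ((le_abs_self _).trans (y.le_opNorm _)).trans
      (mul_le_mul_of_nonneg_left (norm_sup_zero_le x) (norm_nonneg y)))
    (fun c hc x => by
      show y ((c • x) ⊔ 0) = c * y (x ⊔ 0)
      rw [smul_sup_zero hc.le, map_smul, smul_eq_mul])
    (fun a b => by
      show y ((a + b) ⊔ 0) ≤ y (a ⊔ 0) + y (b ⊔ 0)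
      rw [← map_add]
      exact hmono _ _ (add_sup_zero_le a b))
    w hw (y (w ⊔ 0)) le_rfl
    (by linarith [hy (w ⊔ 0) le_sup_right, hy (-w ⊔ 0) le_sup_right])
    (hy _ le_sup_right)
  have hz0 : Pos z := fun x hx => by
    have := hzN (-x)
    rw [sup_eq_right.2 (neg_nonpos.2 hx), map_zero, map_neg] at this
    linarith
  have hzy : ∀ x, 0 ≤ x → z x ≤ y x := fun x hx => by
    have := hzN x
    rwa [sup_eq_left.2 hx] at this
  have e : z (w ⊔ 0) - z (-w ⊔ 0) = y (w ⊔ 0) := by rw [← map_sub, hdec, hz]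
  have e1 := hz0 (-w ⊔ 0) le_sup_right
  have e2 := hzy (w ⊔ 0) le_sup_right
  refine ⟨z, hz0, fun x hx => sub_nonneg.2 (hzy x hx), ?_, by linarith⟩
  show y (w ⊔ 0) - z (w ⊔ 0) = 0
  linarith

theorem good_sup {f g : H0 X} {x x' : X} {y : StrongDual ℝ X} (hf : Good f x y)
    (hg : Good g x' y) (h : y ((x' - x) ⊔ 0) = 0) : Good (f ⊔ g) (x ⊔ x') y := by
  refine ⟨hf.1, fun z hz hyz => ?_⟩
  have e0 : z ((x' - x) ⊔ 0) = 0 := by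
    have h1 := hz ((x' - x) ⊔ 0) le_sup_right
    have h2 : 0 ≤ y ((x' - x) ⊔ 0) - z ((x' - x) ⊔ 0) := hyz ((x' - x) ⊔ 0) le_sup_right
    linarith
  have e1 : x ⊔ x' = x + ((x' - x) ⊔ 0) := by
    rw [add_sup, add_zero, add_sub_cancel, sup_comm]
  have e2 : z x' ≤ z x := by
    have := hz (((x' - x) ⊔ 0) - (x' - x)) (sub_nonneg.2 le_sup_left)
    rw [map_sub, map_sub, e0] at this
    linarith
  rw [H0.sup_apply, hf.2 z hz hyz, hg.2 z hz hyz, e1, map_add, e0, add_zero, sup_eq_left.2 e2]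

theorem Compat.sup {f g : H0 X} {x x' : X} (hf : Compat f x) (hg : Compat g x') :
    Compat (f ⊔ g) (x ⊔ x') := fun y hy => (hf.both hg y hy).bind fun u hu => by
  obtain ⟨z, hz, huz, h1, h2⟩ := exists_split u hu.1.1 (x' - x)
  have hzu : Pos (u - (u - z)) := by rwa [sub_sub_cancel]
  have := Dec.add (P := Good (f ⊔ g) (x ⊔ x')) (u - z) z
    (Dec.leaf _ (good_sup (hu.1.mono huz hzu) (hu.2.mono huz hzu) h1))
    (Dec.leaf _ (by
      rw [sup_comm f, sup_comm x]
      exact good_sup (hu.2.mono hz huz) (hu.1.mono hz huz) (by rwa [neg_sub] at h2)))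
  rwa [sub_add_cancel] at this

theorem Compat.norm_le {f : H0 X} {x : X} (h : Compat f x) : ‖x‖ ≤ ‖f‖ := by
  have habs : Compat |f| |x| := by
    have := h.sup (h.smul (-1))
    rwa [neg_one_smul, neg_one_smul] at this
  obtain ⟨y, hy, hy1, hyx⟩ := exists_norming x
  obtain ⟨n, φ, hφ, rfl⟩ := (habs y hy).exists_fin
  have hadm : Admissible φ := fun z hz => by
    have h1 : ∀ i, |φ i z| ≤ φ i |z| := fun i => by
      have a := (hφ i).1 (|z| - z) (sub_nonneg.2 (le_abs_self z))
      have b := (hφ i).1 (|z| + z) (by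
        rw [← sub_neg_eq_add]
        exact sub_nonneg.2 (neg_le_abs z))
      rw [map_sub] at a
      rw [map_add] at b
      exact abs_le.2 ⟨by linarith, by linarith⟩
    have h2 := hy1 |z|
    rw [norm_abs_eq_norm, _root_.sum_apply] at h2
    exact (Finset.sum_le_sum fun i _ => h1 i).trans (h2.trans hz)
  have h3 := le_fblNorm (f : StrongDual ℝ X → ℝ) φ hadm
  rw [← hyx, H0.norm_def, _root_.sum_apply]
  refine (ENNReal.ofReal_le_iff_le_toReal f.2.2.ne).1 (le_trans ?_ h3)
  rw [← ENNReal.ofReal_sum_of_nonneg fun _ _ => abs_nonneg _]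
  refine ENNReal.ofReal_le_ofReal (Finset.sum_le_sum fun i _ => ?_)
  rw [← (hφ i).2 (φ i) (hφ i).1 (fun x _ => by simp), H0.abs_apply]

variable (X) in
/-- The graph of the barycenter map on the vector lattice generated by the evaluations. -/
def compatGraph : Submodule ℝ (H0 X × X) where
  carrier := {p | Compat p.1 p.2}
  zero_mem' := by
    have := (compat_eval (0 : X)).smul 0
    rwa [zero_smul, zero_smul] at this
  add_mem' := fun hp hq => Compat.add hp hq
  smul_mem' := fun c _ hp => Compat.smul c hp

variable (X) in
/-- Its closure. -/
def baryGraph : Submodule ℝ (H0 X × X) := (compatGraph X).topologicalClosure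

theorem baryGraph_norm {p : H0 X × X} (hp : p ∈ baryGraph X) : ‖p.2‖ ≤ ‖p.1‖ := by
  have hcl : IsClosed {q : H0 X × X | ‖q.2‖ ≤ ‖q.1‖} :=
    isClosed_le continuous_snd.norm continuous_fst.norm
  have hsub : (compatGraph X : Set (H0 X × X)) ⊆ {q : H0 X × X | ‖q.2‖ ≤ ‖q.1‖} :=
    fun q hq => Compat.norm_le hq
  exact closure_minimal hsub hcl hp

theorem baryGraph_sup {p q : H0 X × X} (hp : p ∈ baryGraph X) (hq : q ∈ baryGraph X) :
    (p.1 ⊔ q.1, p.2 ⊔ q.2) ∈ baryGraph X := by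
  have hc : Continuous (fun r : (H0 X × X) × (H0 X × X) =>
      ((r.1.1 ⊔ r.2.1, r.1.2 ⊔ r.2.2) : H0 X × X)) := by fun_prop
  have hmem : ∀ a ∈ (compatGraph X : Set (H0 X × X)), ∀ b ∈ (compatGraph X : Set (H0 X × X)),
      ((a.1 ⊔ b.1, a.2 ⊔ b.2) : H0 X × X) ∈ (compatGraph X : Set (H0 X × X)) :=
    fun _ ha _ hb => Compat.sup ha hb
  exact map_mem_closure₂ (f := fun a b : H0 X × X => ((a.1 ⊔ b.1, a.2 ⊔ b.2) : H0 X × X))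
    hc hp hq hmem

theorem baryGraph_inf {p q : H0 X × X} (hp : p ∈ baryGraph X) (hq : q ∈ baryGraph X) :
    (p.1 ⊓ q.1, p.2 ⊓ q.2) ∈ baryGraph X := by
  have := (baryGraph X).neg_mem
    (baryGraph_sup ((baryGraph X).neg_mem hp) ((baryGraph X).neg_mem hq))
  simpa [neg_sup] using this

theorem exists_mem_baryGraph [CompleteSpace X] {f : H0 X} (hf : f ∈ FBL X) :
    ∃ x, (f, x) ∈ baryGraph X := by
  have hGcl : IsClosed (baryGraph X : Set (H0 X × X)) :=
    Submodule.isClosed_topologicalClosure _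
  have key : FBL X ≤ (baryGraph X).map (LinearMap.fst ℝ (H0 X) X) := by
    refine sInf_le ⟨?_, ?_, ?_, ?_⟩
    · refine isClosed_of_closure_subset fun f hf => ?_
      obtain ⟨u, hu, hlim⟩ := mem_closure_iff_seq_limit.1 hf
      choose p hp hpu using hu
      have hpu' : ∀ n, (p n).1 = u n := hpu
      have hdist : ∀ m n, dist (p m).2 (p n).2 ≤ dist (u m) (u n) := fun m n => by
        rw [dist_eq_norm, dist_eq_norm, ← hpu', ← hpu']
        exact baryGraph_norm ((baryGraph X).sub_mem (hp m) (hp n))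
      have hc : CauchySeq fun n => (p n).2 := by
        refine Metric.cauchySeq_iff.2 fun ε hε => ?_
        obtain ⟨N, hN⟩ := Metric.cauchySeq_iff.1 hlim.cauchySeq ε hε
        exact ⟨N, fun m hm n hn => (hdist m n).trans_lt (hN m hm n hn)⟩
      obtain ⟨x, hx⟩ := cauchySeq_tendsto_of_complete hc
      refine ⟨(f, x), hGcl.mem_of_tendsto (hlim.prodMk_nhds hx)
        (Filter.Eventually.of_forall fun n => ?_), rfl⟩
      rw [← hpu' n]
      exact hp n
    · rintro _ ⟨p, hp, rfl⟩ _ ⟨q, hq, rfl⟩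
      exact ⟨_, baryGraph_sup hp hq, rfl⟩
    · rintro _ ⟨p, hp, rfl⟩ _ ⟨q, hq, rfl⟩
      exact ⟨_, baryGraph_inf hp hq, rfl⟩
    · intro x
      exact ⟨(evalH0 x, x), Submodule.le_topologicalClosure _ (compat_eval x), rfl⟩
  obtain ⟨p, hp, rfl⟩ := key hf
  exact ⟨p.2, hp⟩

theorem baryGraph_unique {f : H0 X} {x x' : X} (h : (f, x) ∈ baryGraph X)
    (h' : (f, x') ∈ baryGraph X) : x = x' := by
  have := baryGraph_norm ((baryGraph X).sub_mem h h')
  simp only [Prod.mk_sub_mk, sub_self, norm_zero] at this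
  exact sub_eq_zero.1 (norm_le_zero_iff.1 this)

theorem exists_isBarycenter [CompleteSpace X] : ∃ β : ↥(FBL X) →L[ℝ] X, IsBarycenter β := by
  choose b hb using fun f : ↥(FBL X) => exists_mem_baryGraph f.2
  let B : ↥(FBL X) →ₗ[ℝ] X :=
    { toFun := b
      map_add' := fun f g => baryGraph_unique (hb (f + g)) ((baryGraph X).add_mem (hb f) (hb g))
      map_smul' := fun c f => baryGraph_unique (hb (c • f)) ((baryGraph X).smul_mem c (hb f)) }
  refine ⟨B.mkContinuous 1 fun f => ?_, ⟨fun f g => ?_, fun f g => ?_⟩, fun x => ?_⟩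
  · rw [one_mul]
    exact baryGraph_norm (hb f)
  · exact baryGraph_unique (hb (f ⊔ g)) (baryGraph_sup (hb f) (hb g))
  · exact baryGraph_unique (hb (f ⊓ g)) (baryGraph_inf (hb f) (hb g))
  · exact baryGraph_unique (hb (delta x)) (Submodule.le_topologicalClosure _ (compat_eval x))

variable [CompleteSpace X]

variable (X) in
/-- The barycenter map `β_X : FBL[X] → X`: the unique lattice homomorphism such that
`β_X ∘ δ_X = id_X`. -/
def barycenter : ↥(FBL X) →L[ℝ] X := Classical.choose (exists_isBarycenter (X := X))

theorem isBarycenter_barycenter : IsBarycenter (barycenter X) :=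
  Classical.choose_spec (exists_isBarycenter (X := X))

variable (X) in
/-- The lattice-lifting property: there is a lattice homomorphism `T : X → FBL[X]` such that
`β_X ∘ T = id_X`. -/
def LatticeLiftingProperty : Prop :=
  ∃ T : X →L[ℝ] ↥(FBL X), IsLatticeHom T ∧ ∀ x : X, barycenter X (T x) = x

end BanachLattice

variable (X) in
/-- `Hom(X, ℝ)`, the set of all real-valued lattice homomorphisms. -/
def latticeHomReal : Set (StrongDual ℝ X) := {φ | IsLatticeHom φ}

variable (X) in
/-- The `σ`-bounded chain condition: `X₊ \ {0}` is a countable union of sets `F n`, `n ≥ 2`, such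
that among any `n` (distinct) elements of `F n` there are two distinct ones that are not
disjoint. -/
def SigmaBoundedChainCondition : Prop :=
  ∃ F : ℕ → Set X, {x : X | 0 ≤ x} \ {0} = ⋃ n ≥ 2, F n ∧
    ∀ n ≥ 2, ∀ G : Finset X, (G : Set X) ⊆ F n → G.card = n →
      ∃ x ∈ G, ∃ y ∈ G, x ≠ y ∧ x ⊓ y ≠ 0

end Lifting

end BanachLatticeLifting

end

open Filter Topology

namespace BanachLatticeLifting

/-! Let `T` be a lattice lifting. As `β ∘ T = id`, `T` is injective, so distinct points of `X` have
images that differ at some functional `φ`. Evaluation at `φ` is a lattice homomorphism on `FBL[X]`,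
and composing it with `T` gives (i).

For (ii), the elements of `FBL[X]` are weak-star continuous on bounded sets
(`FBL_le_weakStarContinuous`). If `x > 0`, then `T x` is positive at some `φ` in the unit ball,
hence near `φ` inside the ball of radius 3, where "near" is tested by `k` vectors of norm at most
`R`. The pairs `(k, R)` cut the positive cone minus zero into countably many pieces.

Inside one piece, colour a pair `(i, j)` by the integer parts of the values of `φ i` on the vectors
of `j`, and of `φ j` on those of `i`. There are finitely many colours, so a large family contains a
triple `a, m, b` on which the colours agree. Then `ψ = φ a - φ m + φ b` has norm at most 3 and lies
in the neighbourhoods of both `φ a` and `φ b`. Both images are positive at `ψ`, so the two elements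
are not disjoint. -/

/-! ### Ramsey's theorem for triples -/

/-- Multicolour Ramsey theorem for triangles, for colourings of ordered pairs. -/
theorem exists_monochromatic_triple {V γ : Type*} [DecidableEq γ] (C : Finset γ) :
    ∃ N : ℕ, ∀ (S : Finset V) (χ : V → V → γ),
      (∀ i ∈ S, ∀ j ∈ S, i ≠ j → χ i j ∈ C) → N ≤ S.card →
      ∃ a ∈ S, ∃ m ∈ S, ∃ b ∈ S, a ≠ m ∧ a ≠ b ∧ m ≠ b ∧ χ a m = χ a b ∧ χ a b = χ m b := by
  classical
  induction h : C.card generalizing C with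
  | zero =>
    refine ⟨2, fun S χ hχ hS => ?_⟩
    obtain ⟨a, ha, b, hb, hab⟩ := Finset.one_lt_card.1 hS
    have := hχ a ha b hb hab
    rw [Finset.card_eq_zero.1 h] at this
    simp at this
  | succ c ih =>
    choose! N hN using fun (d : γ) (hd : d ∈ C) =>
      ih (C.erase d) (by rw [Finset.card_erase_of_mem hd, h]; rfl)
    -- The bound for the remaining colours may depend on the discarded colour `d`; the sum dominates
    -- all these bounds. Removing `a` still leaves more than `C.card` times this sum, as the
    -- pigeonhole principle requires.
    refine ⟨C.card * (∑ d ∈ C, N d) + 2, fun S χ hχ hS => ?_⟩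
    obtain ⟨a, ha⟩ : S.Nonempty := Finset.card_pos.1 (by omega)
    obtain ⟨d, hd, hlt⟩ := Finset.exists_lt_card_fiber_of_mul_lt_card_of_maps_to
      (s := S.erase a) (t := C) (f := χ a) (n := ∑ d ∈ C, N d)
      (fun j hj => hχ a ha j (Finset.mem_of_mem_erase hj) (Finset.ne_of_mem_erase hj).symm)
      (by rw [Finset.card_erase_of_mem ha]; omega)
    set S' := (S.erase a).filter (fun j => χ a j = d) with hS'
    have hmem : ∀ j ∈ S', j ∈ S ∧ a ≠ j ∧ χ a j = d := fun j hj => by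
      simp only [hS', Finset.mem_filter, Finset.mem_erase] at hj
      exact ⟨hj.1.2, hj.1.1.symm, hj.2⟩
    -- Either a pair of colour `d` inside the fibre completes a triple with `a`, or the fibre avoids
    -- `d` and induction applies with one colour fewer.
    by_cases H : ∃ m ∈ S', ∃ b ∈ S', m ≠ b ∧ χ m b = d
    · obtain ⟨m, hm, b, hb, hmb, e⟩ := H
      exact ⟨a, ha, m, (hmem m hm).1, b, (hmem b hb).1, (hmem m hm).2.1, (hmem b hb).2.1, hmb,
        (hmem m hm).2.2.trans (hmem b hb).2.2.symm, (hmem b hb).2.2.trans e.symm⟩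
    · push Not at H
      obtain ⟨x, hx, m, hm, b, hb, r⟩ := hN d hd S' χ
        (fun i hi j hj hij => Finset.mem_erase.2
          ⟨H i hi j hj hij, hχ i (hmem i hi).1 j (hmem j hj).1 hij⟩)
        ((Finset.single_le_sum (f := N) (fun _ _ => Nat.zero_le _) hd).trans hlt.le)
      exact ⟨x, (hmem x hx).1, m, (hmem m hm).1, b, (hmem b hb).1, r⟩

/-! ### Weak-star continuity on bounded sets -/

section Free

variable {E : Type*} [NormedAddCommGroup E] [NormedSpace ℝ E]

/-- The one-element family `φ / ‖φ‖` is admissible. Consequently, norm convergence in `H₀[E]` is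
uniform on bounded subsets of the dual. -/
theorem H0.abs_apply_le (f : H0 E) (φ : StrongDual ℝ E) : |f φ| ≤ ‖f‖ * ‖φ‖ := by
  rcases eq_or_ne φ 0 with rfl | hφ
  · have h := f.2.1 2 0 two_pos
    rw [smul_zero] at h
    have h0 : f (0 : StrongDual ℝ E) = 0 := by linarith
    rw [h0]
    simp
  have hc : 0 < ‖φ‖ := norm_pos_iff.2 hφ
  have hadm : Admissible (fun _ : Fin 1 => ‖φ‖⁻¹ • φ) := by
    intro x hx
    have h1 : |φ x| ≤ ‖φ‖ := by
      have := φ.le_opNorm x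
      rw [Real.norm_eq_abs] at this
      nlinarith
    simp only [Finset.univ_unique, Finset.sum_const, Finset.card_singleton, one_smul,
      _root_.smul_apply, smul_eq_mul, abs_mul, abs_inv, abs_norm]
    rw [inv_mul_le_iff₀ hc, mul_one]
    exact h1
  have h2 := le_fblNorm (f : StrongDual ℝ E → ℝ) _ hadm
  simp only [Finset.univ_unique, Finset.sum_const, Finset.card_singleton, one_smul] at h2
  have h3 := (ENNReal.ofReal_le_iff_le_toReal f.2.2.ne).1 h2
  rw [f.2.1 _ φ (inv_pos.2 hc), abs_mul, abs_inv, abs_norm, inv_mul_le_iff₀ hc] at h3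
  rw [mul_comm]
  exact h3

/-- The weak-star neighbourhood filter of `φ`, relative to the ball of radius `M`. -/
def weakStarNhdsWithin (M : ℝ) (φ : StrongDual ℝ E) : Filter (StrongDual ℝ E) :=
  comap (fun ψ : StrongDual ℝ E => (ψ : E → ℝ)) (𝓝 (φ : E → ℝ)) ⊓ 𝓟 {ψ | ‖ψ‖ ≤ M}

variable (E) in
/-- The functions in `H₀[E]` that are weak-star continuous on the ball of radius `M`. -/
def weakStarContinuous (M : ℝ) : Submodule ℝ (H0 E) where
  carrier := {f | ∀ φ : StrongDual ℝ E, ‖φ‖ ≤ M → Tendsto f (weakStarNhdsWithin M φ) (𝓝 (f φ))}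
  zero_mem' := fun _ _ => tendsto_const_nhds
  add_mem' := fun hf hg φ h => (hf φ h).add (hg φ h)
  smul_mem' := fun c _ hf φ h => (hf φ h).const_mul c

/-- A uniform limit of continuous functions is continuous, by an `ε / 3` argument. -/
theorem isClosed_weakStarContinuous (M : ℝ) :
    IsClosed (weakStarContinuous E M : Set (H0 E)) := by
  refine isClosed_of_closure_subset fun f hf φ hφ => Metric.tendsto_nhds.2 fun ε hε => ?_
  have hM : 0 ≤ M := (norm_nonneg φ).trans hφ
  -- Using `M + 1` instead of `M` keeps the denominator positive when `M = 0`.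
  obtain ⟨g, hg, hfg⟩ := Metric.mem_closure_iff.1 hf (ε / (3 * (M + 1))) (by positivity)
  rw [dist_eq_norm] at hfg
  have key : ∀ ψ : StrongDual ℝ E, ‖ψ‖ ≤ M → |f ψ - g ψ| < ε / 3 := fun ψ hψ => by
    have h := (f - g).abs_apply_le ψ
    rw [sub_eq_add_neg f g, H0.add_apply, H0.neg_apply, ← sub_eq_add_neg,
      ← sub_eq_add_neg] at h
    rw [lt_div_iff₀ (by positivity)] at hfg
    nlinarith [norm_nonneg (f - g), norm_nonneg ψ]
  have h1 := Metric.tendsto_nhds.1 (hg φ hφ) (ε / 3) (by positivity)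
  have h2 : ∀ᶠ ψ in weakStarNhdsWithin M φ, ‖ψ‖ ≤ M :=
    mem_inf_of_right (mem_principal_self {ψ : StrongDual ℝ E | ‖ψ‖ ≤ M})
  filter_upwards [h1, h2] with ψ h1 h2
  have a := abs_lt.1 (key ψ h2)
  have b := abs_lt.1 (key φ hφ)
  rw [Real.dist_eq] at h1 ⊢
  have c := abs_lt.1 h1
  exact abs_lt.2 ⟨by linarith, by linarith⟩

/-- By minimality of `FBL[E]`: the functions on the right form a closed vector sublattice containing
the evaluations. -/
theorem FBL_le_weakStarContinuous (M : ℝ) : FBL E ≤ weakStarContinuous E M := by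
  refine sInf_le ⟨isClosed_weakStarContinuous M,
    fun f hf g hg φ h => (hf φ h).sup_nhds (hg φ h),
    fun f hf g hg φ h => (hf φ h).inf_nhds (hg φ h), fun x φ _ => ?_⟩
  exact (((continuous_apply x).tendsto (φ : E → ℝ)).comp tendsto_comap).mono_left inf_le_left

/-! ### Common points of positivity -/

variable (E) in
/-- The functions on the dual that are positive on the part in the ball of radius `3` of a
weak-star neighbourhood, given by `k` vectors of norm at most `R`, of a point of the unit ball. -/
def positiveNear (k R : ℕ) : Set (StrongDual ℝ E → ℝ) :=
  {f | ∃ (φ : StrongDual ℝ E) (x : Fin k → E), ‖φ‖ ≤ 1 ∧ (∀ l, ‖x l‖ ≤ R) ∧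
    ∀ ψ : StrongDual ℝ E, ‖ψ‖ ≤ 3 → (∀ l, |ψ (x l) - φ (x l)| < 1) → 0 < f ψ}

theorem exists_mem_positiveNear {f : H0 E} (hf : f ∈ FBL E) {φ : StrongDual ℝ E}
    (hpos : 0 < f φ) : ∃ k R, (f : StrongDual ℝ E → ℝ) ∈ positiveNear E k R := by
  -- Positive homogeneity allows normalising `φ`.
  wlog hφ : ‖φ‖ ≤ 1 generalizing φ
  · have hc : 0 < ‖φ‖ := zero_lt_one.trans (not_le.1 hφ)
    refine this (φ := ‖φ‖⁻¹ • φ) ?_ ?_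
    · rw [f.2.1 _ _ (inv_pos.2 hc)]
      positivity
    · rw [norm_smul, norm_inv, norm_norm, inv_mul_cancel₀ hc.ne']
  have hev := (FBL_le_weakStarContinuous 3 hf φ (hφ.trans (by norm_num))).eventually_const_lt hpos
  rw [weakStarNhdsWithin, eventually_inf_principal] at hev
  obtain ⟨U, hU, hsub⟩ := mem_comap.1 hev
  rw [nhds_pi] at hU
  obtain ⟨I, hI, t, ht, hIt⟩ := mem_pi.1 hU
  choose r hr0 hr using fun x => Metric.mem_nhds_iff.1 (ht x)
  let e := hI.toFinset.equivFin.symm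
  -- Dividing each test vector by its radius turns all the radii of the basic neighbourhood into 1.
  let x : Fin hI.toFinset.card → E := fun l => (r (e l))⁻¹ • (e l : E)
  obtain ⟨R, hR⟩ := exists_nat_ge (∑ l, ‖x l‖)
  refine ⟨_, R, φ, x, hφ, fun l => (Finset.single_le_sum (f := fun l => ‖x l‖)
    (fun _ _ => norm_nonneg _) (Finset.mem_univ l)).trans hR, fun ψ hψ h => ?_⟩
  refine hsub (hIt fun y hy => hr y ?_) hψ
  have h1 := h (e.symm ⟨y, hI.mem_toFinset.2 hy⟩)
  simp only [x, Equiv.apply_symm_apply, map_smul, smul_eq_mul, ← mul_sub, abs_mul, abs_inv,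
    abs_of_pos (hr0 y)] at h1
  rw [inv_mul_lt_iff₀ (hr0 y), mul_one] at h1
  exact h1

/-- Ramsey replaces an arbitrary large family by a triple in which `φ m` imitates `φ b` on the
vectors of `a` and `φ a` on the vectors of `b`, up to an error below 1. -/
theorem exists_common_positive {V : Type*} (f : V → StrongDual ℝ E → ℝ) (k R : ℕ) :
    ∃ N : ℕ, ∀ S : Finset V, (∀ i ∈ S, f i ∈ positiveNear E k R) → N ≤ S.card →
      ∃ i ∈ S, ∃ j ∈ S, i ≠ j ∧ ∃ ψ, 0 < f i ψ ∧ 0 < f j ψ := by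
  -- Since `‖φ i‖ ≤ 1` and the test vectors have norm at most `R`, all the floors lie between `-R`
  -- and `R`.
  let D : Finset (Fin k → ℤ) := Fintype.piFinset fun _ => Finset.Icc (-R : ℤ) R
  obtain ⟨N, hN⟩ := exists_monochromatic_triple (V := V) (D ×ˢ D)
  refine ⟨N, fun S hS hcard => ?_⟩
  choose! φ x hφ hx hpos using hS
  let col : V → V → Fin k → ℤ := fun i j l => ⌊φ i (x j l)⌋
  have hcol : ∀ i ∈ S, ∀ j ∈ S, col i j ∈ D := fun i hi j hj => by
    refine Fintype.mem_piFinset.2 fun l => ?_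
    have h1 : |φ i (x j l)| ≤ R := by
      have h := (φ i).le_of_opNorm_le (hφ i hi) (x j l)
      rw [one_mul, Real.norm_eq_abs] at h
      exact h.trans (hx j hj l)
    obtain ⟨h2, h3⟩ := abs_le.1 h1
    refine Finset.mem_Icc.2 ⟨Int.le_floor.2 (by push_cast; exact h2), ?_⟩
    exact_mod_cast (Int.floor_le (φ i (x j l))).trans h3
  obtain ⟨a, ha, m, hm, b, hb, -, hab, -, h1, h2⟩ := hN S (fun i j => (col i j, col j i))
    (fun i hi j hj _ => Finset.mem_product.2 ⟨hcol i hi j hj, hcol j hj i hi⟩) hcard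
  -- The colouring is not symmetric: the vectors of `a` are compared through second components,
  -- those of `b` through first components.
  have e1 : ∀ l, ⌊φ b (x a l)⌋ = ⌊φ m (x a l)⌋ := fun l => (congrFun (Prod.ext_iff.1 h1).2 l).symm
  have e2 : ∀ l, ⌊φ a (x b l)⌋ = ⌊φ m (x b l)⌋ := fun l => congrFun (Prod.ext_iff.1 h2).1 l
  have hψ : ‖φ a - φ m + φ b‖ ≤ 3 := by
    have := norm_add_le (φ a - φ m) (φ b)
    have := norm_sub_le (φ a) (φ m)
    linarith [hφ a ha, hφ m hm, hφ b hb]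
  -- On the vectors of `a` this functional differs from `φ a` by `φ b - φ m`; on those of `b` it
  -- differs from `φ b` by `φ a - φ m`. Equal floors make both differences smaller than 1.
  refine ⟨a, ha, b, hb, hab, φ a - φ m + φ b, hpos a ha _ hψ fun l => ?_,
    hpos b hb _ hψ fun l => ?_⟩
  · rw [_root_.add_apply, _root_.sub_apply, show ∀ p q r : ℝ, p - q + r - p = r - q by intros; ring]
    exact Int.abs_sub_lt_one_of_floor_eq_floor (e1 l)
  · rw [_root_.add_apply, _root_.sub_apply, add_sub_cancel_right]
    exact Int.abs_sub_lt_one_of_floor_eq_floor (e2 l)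

/-! ### Point evaluations as lattice homomorphisms; the chain condition from a countable cover -/

/-- Evaluation at a functional, as a bounded functional on the free Banach lattice. -/
noncomputable def evalAt (φ : StrongDual ℝ E) : ↥(FBL E) →L[ℝ] ℝ :=
  LinearMap.mkContinuous
    { toFun := fun f => (f : H0 E) φ
      map_add' := fun _ _ => rfl
      map_smul' := fun _ _ => rfl } ‖φ‖ fun f => by
    rw [mul_comm]
    exact (f : H0 E).abs_apply_le φ

theorem isLatticeHom_evalAt (φ : StrongDual ℝ E) : IsLatticeHom (evalAt φ) :=
  ⟨fun _ _ => rfl, fun _ _ => rfl⟩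

end Free

theorem IsLatticeHom.comp {X Y Z : Type*} [NormedAddCommGroup X] [NormedSpace ℝ X] [Lattice X]
    [NormedAddCommGroup Y] [NormedSpace ℝ Y] [Lattice Y]
    [NormedAddCommGroup Z] [NormedSpace ℝ Z] [Lattice Z] {S : Y →L[ℝ] Z} {T : X →L[ℝ] Y}
    (hS : IsLatticeHom S) (hT : IsLatticeHom T) : IsLatticeHom (S.comp T) :=
  ⟨fun x y => by simp only [ContinuousLinearMap.comp_apply, hT.map_sup, hS.map_sup],
    fun x y => by simp only [ContinuousLinearMap.comp_apply, hT.map_inf, hS.map_inf]⟩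

/-- Here each piece may have its own threshold `N p`. Through the pairing function each piece recurs
at infinitely many indices `n`, and it is admitted only when `N p ≤ n`, so that `n` itself serves as
the threshold. -/
theorem sigmaBoundedChainCondition_of_cover {X : Type*} [NormedAddCommGroup X] [Lattice X]
    (C : ℕ → Set X)
    (hcover : ∀ x : X, 0 ≤ x → x ≠ 0 → ∃ p, x ∈ C p)
    (hC : ∀ p, ∃ N : ℕ, ∀ G : Finset X, (∀ x ∈ G, 0 ≤ x ∧ x ∈ C p) → N ≤ G.card →
      ∃ x ∈ G, ∃ y ∈ G, x ≠ y ∧ x ⊓ y ≠ 0) :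
    SigmaBoundedChainCondition X := by
  choose N hN using hC
  refine ⟨fun n => {x | (0 ≤ x ∧ x ≠ 0) ∧ x ∈ C n.unpair.1 ∧ N n.unpair.1 ≤ n}, ?_,
    fun n _ G hG hcard => hN n.unpair.1 G (fun x hx => ⟨(hG hx).1.1, (hG hx).2.1⟩) ?_⟩
  · refine Set.Subset.antisymm (fun x hx => ?_) (fun x hx => ?_)
    · obtain ⟨p, hp⟩ := hcover x hx.1 hx.2
      have hle := Nat.right_le_pair p (N p + 2)
      -- This index is at least `N p + 2`, which secures both `2 ≤ n` and `N p ≤ n`.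
      refine Set.mem_iUnion₂.2 ⟨Nat.pair p (N p + 2), by omega, hx, ?_⟩
      simp only [Nat.unpair_pair]
      exact ⟨hp, by omega⟩
    · obtain ⟨n, _, h⟩ := Set.mem_iUnion₂.1 hx
      exact h.1
  -- The inequality `N p ≤ n` is part of membership in the `n`-th set, so it is read off from an
  -- element of `G`, which exists because `n ≥ 2`.
  · rcases G.eq_empty_or_nonempty with rfl | ⟨x, hx⟩
    · simp at hcard
      omega
    · exact hcard ▸ (hG hx).2.2

end BanachLatticeLifting

/-! ### The corollary -/

open BanachLatticeLifting in
theorem corollary2p5 {X : Type*} [NormedAddCommGroup X] [NormedSpace ℝ X] [CompleteSpace X]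
    [Lattice X] [IsOrderedAddMonoid X] [IsOrderedModule ℝ X] [HasSolidNorm X]
    (hX : BanachLatticeLifting.LatticeLiftingProperty X) :
    (∀ x y : X, x ≠ y → ∃ φ ∈ BanachLatticeLifting.latticeHomReal X, φ x ≠ φ y) ∧
      BanachLatticeLifting.SigmaBoundedChainCondition X := by
  obtain ⟨T, hT, hβ⟩ := hX
  have hsep : ∀ x y : X, x ≠ y → ∃ φ, (T x : H0 X) φ ≠ (T y : H0 X) φ := fun x y hxy => by
    by_contra! h
    exact hxy (by rw [← hβ x, ← hβ y, Subtype.ext (H0.ext h)])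
  refine ⟨fun x y hxy => ?_, ?_⟩
  · obtain ⟨φ, hφ⟩ := hsep x y hxy
    exact ⟨(evalAt φ).comp T, (isLatticeHom_evalAt φ).comp hT, hφ⟩
  refine sigmaBoundedChainCondition_of_cover
    (fun p => {x | ((T x : H0 X) : StrongDual ℝ X → ℝ) ∈ positiveNear X p.unpair.1 p.unpair.2})
    (fun x hx hx0 => ?_) fun p => ?_
  · obtain ⟨φ, hφ⟩ := hsep x 0 hx0
    -- Preserving suprema makes `T` positive, so being nonzero at `φ` means being strictly positive
    -- there.
    have h0 : 0 ≤ (T x : H0 X) φ := by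
      have h := hT.map_sup x 0
      rw [sup_eq_left.2 hx, map_zero] at h
      rw [h]
      exact le_sup_right
    rw [map_zero] at hφ
    obtain ⟨k, R, h⟩ := exists_mem_positiveNear (T x).2 (lt_of_le_of_ne h0 (Ne.symm hφ))
    exact ⟨Nat.pair k R, by simpa only [Set.mem_ofPred_eq, Nat.unpair_pair] using h⟩
  · obtain ⟨N, hN⟩ := exists_common_positive
      (fun x : X => ((T x : H0 X) : StrongDual ℝ X → ℝ)) p.unpair.1 p.unpair.2
    refine ⟨N, fun G hG hcard => ?_⟩
    obtain ⟨x, hx, y, hy, hxy, ψ, h1, h2⟩ := hN G (fun x hx => (hG x hx).2) hcard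
    refine ⟨x, hx, y, hy, hxy, fun h => ?_⟩
    -- If `x ⊓ y = 0`, the minimum of `T x` and `T y` would vanish at `ψ`, where both are positive.
    have h3 := hT.map_inf x y
    rw [h, map_zero] at h3
    have h4 : (0 : ℝ) = (T x : H0 X) ψ ⊓ (T y : H0 X) ψ :=
      congrArg (fun f : ↥(FBL X) => (f : H0 X) ψ) h3
    exact (lt_inf_iff.2 ⟨h1, h2⟩).ne h4
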